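/- **Setting.** A deterministic Turing machine $M=(Q,\Sigma,\Gamma,\vdash,\sqcup,\delta,q_0,q_{\mathrm{final}})$ has finite state set $Q$, input alphabet $\Sigma=\{0,1\}$, finite tape alphabet $\Gamma\supseteq\Sigma$, a left end marker $\vdash\,\in\Gamma\setminus\Sigma$, a blank $\sqcup\in\Gamma\setminus\Sigma$ and a transition function $\delta:Q\times\Gamma\to Q\times\Gamma\times\{L,R\}$. Its tape is semi-infinite: cell $0$ initially holds $\vdash$, the input $w$ occupies the cells $1,\dots,|w|$, and all other cells are blank; the head starts in cell $1$ and the state is $q_0$; a left move in cell $0$ leaves the head there. $M$ stops as soon as its state is $q_{\mathrm{final}}$; its running time $T_M(w)$ is the number of steps made until then, and its output $M(w)$ is the content of the cells $1,2,\dots$ before the first blank. $M$ is *polynomial-time* on bit strings if for every $w\in\{0,1\}^*$ it stops with an output $M(w)\in\{0,1\}^*$, and $T_M(w)\le P(|w|)$ for a fixed polynomial $P$. RaML is the first-order call-by-value functional language with unit, sum, product and list types, recursive function definitions $\mathsf{fun}\ f\ x=e$, application, $\mathsf{let}$, affine variables with an explicit $\mathsf{share}$ construct, and $\mathsf{tick}\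 q$ ($q\in\mathbb{Q}$). In the *tick metric*, the cost of an evaluation is the sum of the $q$ over all executed $\mathsf{tick}\ q$. Bit strings are values of type $L(\mathbf 1+\mathbf 1)$. Univariate polynomial AARA is the affine type system for RaML in which every list type $L^{\vec q}(b)$ carries a vector $\vec q=(q_1,\dots,q_k)$ of non-negative rationals; a list of length $n$ then stores the potential $\sum_{i=1}^k q_i\binom ni$, in addition to that of its elements, and the judgment $\Gamma;p\vdash e:\langle\tau,p'\rangle$ says that the potential of $\Gamma$ together with $p$ pays for the tick cost of $e$ and leaves $p'$ and the potential of the result of type $\tau$. Univariate AARA *infers* $\langle b,p\rangle\to\langle b',p'\rangle$ for a program in degree $k$ if the program has a derivation of this type in which all vectors have length $k$ and every function definition is assigned a single annotated arrow type (resource-monomorphic recursion). **Theorem (Embedding of polynomial-time Turing machines in RaML).** Let $M$ be a polynomial-time Turing machine on bit strings. There are a RaML program $M'$, a degree $k\in\mathbb N$, vectors $\vec q,\vec r\in\mathbb Q_{\ge0}^k$ and numbers $p,s\in\mathbb Q_{\ge0}$ such that 1. for every $w\in\{0,1\}^*$, the evaluation of $M'$ on $w$ terminates with result $M'(w)=M(w)$;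 2. for every $w\in\{0,1\}^*$, the cost of $M'$ on $w$ in the tick metric is at least the running time $T_M(w)$; 3. univariate AARA infers, in degree $k$, the type $$M':\langle L^{\vec q}(\mathbf 1+\mathbf 1),\,p\rangle\to\langle L^{\vec r}(\mathbf 1+\mathbf 1),\,s\rangle ,$$ and the corresponding polynomial $p+\sum_{i=1}^{k}q_i\binom{|w|}{i}$ is an upper bound for the cost of $M'$ on $w$ in the tick metric, for every $w\in\{0,1\}^*$. -/

import Mathlib

open scoped NNRat

/-! ## Turing machines -/

inductive Dir where
  | L
  | R

/-- A deterministic one-tape Turing machine with state set `Q`, input alphabet `{0, 1}` (included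
in the tape alphabet by `bit`) and tape alphabet `Γ`. -/
structure TuringMachine (Q Γ : Type*) where
  bit : Bool → Γ
  bit_injective : Function.Injective bit
  leftEnd : Γ
  leftEnd_notMem : leftEnd ∉ Set.range bit
  blank : Γ
  blank_notMem : blank ∉ Set.range bit
  δ : Q × Γ → Q × Γ × Dir
  q₀ : Q
  qFinal : Q

namespace TuringMachine

variable {Q Γ : Type*}

/-- The tape is semi-infinite: its cells are numbered `0, 1, 2, …`. -/
structure Config (Q Γ : Type*) where
  state : Q
  head : ℕ
  tape : ℕ → Γ

/-- Cell `0` holds the left end marker, the input starts in cell `1`, the other cells are blank. -/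
def initTape (M : TuringMachine Q Γ) (w : List Bool) : ℕ → Γ
  | 0 => M.leftEnd
  | i + 1 => (w[i]?).elim M.blank M.bit

def init (M : TuringMachine Q Γ) (w : List Bool) : Config Q Γ :=
  ⟨M.q₀, 1, M.initTape w⟩

/-- A left move in cell `0` leaves the head there (truncated subtraction). -/
def moveHead : Dir → ℕ → ℕ
  | .L, h => h - 1
  | .R, h => h + 1

def step (M : TuringMachine Q Γ) (c : Config Q Γ) : Config Q Γ :=
  let r := M.δ (c.state, c.tape c.head)
  ⟨r.1, moveHead r.2.2 c.head, Function.update c.tape c.head r.2.1⟩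

def configAt (M : TuringMachine Q Γ) (w : List Bool) (t : ℕ) : Config Q Γ :=
  M.step^[t] (M.init w)

/-- On input `w` the machine enters its final state for the first time after exactly `t` steps. -/
def HaltsIn (M : TuringMachine Q Γ) (w : List Bool) (t : ℕ) : Prop :=
  (M.configAt w t).state = M.qFinal ∧ ∀ s < t, (M.configAt w s).state ≠ M.qFinal

/-- The tape content between the cell of the left end marker and the first blank is `u`. -/
def TapeHolds (M : TuringMachine Q Γ) (tape : ℕ → Γ) (u : List Bool) : Prop :=
  (∀ i (hi : i < u.length), tape (i + 1) = M.bit u[i]) ∧ tape (u.length + 1) = M.blank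

/-- `M.Runs w u t`: on input `w`, the machine halts with output `u` and running time `t`. -/
def Runs (M : TuringMachine Q Γ) (w u : List Bool) (t : ℕ) : Prop :=
  M.HaltsIn w t ∧ M.TapeHolds (M.configAt w t).tape u

/-- On every bit string the machine outputs a bit string, within time polynomial in the length. -/
def PolyTime (M : TuringMachine Q Γ) : Prop :=
  ∃ p : Polynomial ℕ, ∀ w : List Bool, ∃ u t, M.Runs w u t ∧ t ≤ p.eval w.length

end TuringMachine

namespace RaML

/-! ## Resource-Aware ML: programs and the cost semantics of the tick metric -/

/-- Expressions in let-normal form. Variable symbols, for values and for functions, are natural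
numbers. The constructors `unit`, `nil`, `cons`, `func`, `letE` stand for the unit element, `[]`,
`x₁ :: x₂`, `fun f x = e` and `let x = e₁ in e₂`. -/
inductive Expr where
  | var (x : ℕ)
  | unit
  | inl (x : ℕ)
  | inr (x : ℕ)
  | caseSum (x y : ℕ) (el er : Expr)
  | pair (x₁ x₂ : ℕ)
  | casePair (x x₁ x₂ : ℕ) (e : Expr)
  | nil
  | cons (x₁ x₂ : ℕ)
  | caseList (x : ℕ) (e₀ : Expr) (x₁ x₂ : ℕ) (e₁ : Expr)
  | func (f x : ℕ) (e : Expr)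
  | app (f x : ℕ)
  | tick (q : ℚ)
  | letE (x : ℕ) (e₁ e₂ : Expr)
  | share (x x₁ x₂ : ℕ) (e : Expr)

/-- Semantic values; `closure V f x e` is the closure of `fun f x = e` in the environment `V`. -/
inductive Val where
  | unit
  | inl (v : Val)
  | inr (v : Val)
  | pair (v₁ v₂ : Val)
  | nil
  | cons (v₁ v₂ : Val)
  | closure (V : ℕ → Option Val) (f x : ℕ) (e : Expr)

abbrev Env := ℕ → Option Val

def Env.empty : Env := fun _ => none

/-- The environment `V, x ↦ v`. -/
def Env.ext (V : Env) (x : ℕ) (v : Val) : Env := Function.update V x (some v)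

/-- `Eval V e v c` is the judgment `V ⊢ e ⇓ v | c` of call-by-value evaluation, where `c` is the
cost in the tick metric: `tick q` costs `q`, and nothing else has a cost. -/
inductive Eval : Env → Expr → Val → ℚ → Prop
  | var {V x v} (hx : V x = some v) : Eval V (.var x) v 0
  | unit {V} : Eval V .unit .unit 0
  | inl {V x v} (hx : V x = some v) : Eval V (.inl x) (.inl v) 0
  | inr {V x v} (hx : V x = some v) : Eval V (.inr x) (.inr v) 0
  | caseInl {V x y el er v v' q} (hx : V x = some (.inl v))
      (he : Eval (V.ext y v) el v' q) : Eval V (.caseSum x y el er) v' q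
  | caseInr {V x y el er v v' q} (hx : V x = some (.inr v))
      (he : Eval (V.ext y v) er v' q) : Eval V (.caseSum x y el er) v' q
  | pair {V x₁ x₂ v₁ v₂} (h₁ : V x₁ = some v₁) (h₂ : V x₂ = some v₂) :
      Eval V (.pair x₁ x₂) (.pair v₁ v₂) 0
  | casePair {V x x₁ x₂ e v₁ v₂ v q} (hx : V x = some (.pair v₁ v₂))
      (he : Eval ((V.ext x₁ v₁).ext x₂ v₂) e v q) : Eval V (.casePair x x₁ x₂ e) v q
  | nil {V} : Eval V .nil .nil 0
  | cons {V x₁ x₂ v₁ v₂} (h₁ : V x₁ = some v₁) (h₂ : V x₂ = some v₂) :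
      Eval V (.cons x₁ x₂) (.cons v₁ v₂) 0
  | caseNil {V x e₀ x₁ x₂ e₁ v q} (hx : V x = some .nil)
      (he : Eval V e₀ v q) : Eval V (.caseList x e₀ x₁ x₂ e₁) v q
  | caseCons {V x e₀ x₁ x₂ e₁ v₁ v₂ v q} (hx : V x = some (.cons v₁ v₂))
      (he : Eval ((V.ext x₁ v₁).ext x₂ v₂) e₁ v q) : Eval V (.caseList x e₀ x₁ x₂ e₁) v q
  | func {V f x e} : Eval V (.func f x e) (.closure V f x e) 0
  | app {V U : Env} {x₁ x₂ f x e w v q} (h₁ : V x₁ = some (.closure U f x e))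
      (h₂ : V x₂ = some w) (he : Eval ((U.ext f (.closure U f x e)).ext x w) e v q) :
      Eval V (.app x₁ x₂) v q
  | tick {V q} : Eval V (.tick q) .unit q
  | letE {V x e₁ e₂ v₁ v₂ q p} (h₁ : Eval V e₁ v₁ q) (h₂ : Eval (V.ext x v₁) e₂ v₂ p) :
      Eval V (.letE x e₁ e₂) v₂ (q + p)
  | share {V x x₁ x₂ e v v' q} (hx : V x = some v)
      (he : Eval ((V.ext x₁ v).ext x₂ v) e v' q) : Eval V (.share x x₁ x₂ e) v' q

/-- A bit, as a value of type `1 + 1`. -/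
def Val.ofBool : Bool → Val
  | false => .inl .unit
  | true => .inr .unit

/-- A bit string, as a value of type `L(1 + 1)`. -/
def Val.ofBits : List Bool → Val
  | [] => .nil
  | b :: w => .cons (.ofBool b) (.ofBits w)

/-- The closed program `P` evaluates to a function which, applied to the bit string `w`, returns
the bit string `u`; the total cost in the tick metric is `c`. -/
def Expr.Runs (P : Expr) (w u : List Bool) (c : ℚ) : Prop :=
  ∃ v c₁ c₂, Eval .empty P v c₁ ∧
    Eval ((Env.empty.ext 0 v).ext 1 (.ofBits w)) (.app 0 1) (.ofBits u) c₂ ∧ c = c₁ + c₂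

/-! ## Univariate polynomial AARA of maximal degree `k`, for the tick metric -/

/-- Potential vectors `(q₁, …, q_k)`, where `q_{i+1}` is the entry with index `i : Fin k`. -/
abbrev Pot (k : ℕ) := Fin k → ℚ≥0

/-- The first component `q₁` (which is `0` in degree `0`). -/
def Pot.head {k : ℕ} (q : Pot k) : ℚ≥0 := if h : 0 < k then q ⟨0, h⟩ else 0

/-- The additive shift `(q₁ + q₂, q₂ + q₃, …, q_{k-1} + q_k, q_k)`. -/
def Pot.shift {k : ℕ} (q : Pot k) : Pot k :=
  fun i => q i + if h : (i : ℕ) + 1 < k then q ⟨i + 1, h⟩ else 0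

/-- The potential `∑ᵢ qᵢ * (n choose i)`, where `i` runs from `1` to `k`, of a list of length `n`
(apart from the potential of its elements). -/
def Pot.phi {k : ℕ} (q : Pot k) (n : ℕ) : ℚ≥0 := ∑ i : Fin k, q i * (n.choose (i + 1) : ℚ≥0)

/-- Resource-annotated base types. -/
inductive BTy (k : ℕ) where
  | unit
  | sum (b₁ b₂ : BTy k)
  | prod (b₁ b₂ : BTy k)
  | list (q : Pot k) (b : BTy k)

/-- Resource-annotated arrow types `⟨dom, domPot⟩ → ⟨cod, codPot⟩`. -/
structure Arrow (k : ℕ) where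
  dom : BTy k
  domPot : ℚ≥0
  cod : BTy k
  codPot : ℚ≥0

/-- Annotated types of variables and expressions. A function is associated with a set `𝒯` of
resource-annotated arrow types. -/
inductive ATy (k : ℕ) where
  | base (b : BTy k)
  | fn (𝒯 : Set (Arrow k))

/-- `|b|`: all annotations are replaced by zero. -/
def BTy.strip {k : ℕ} : BTy k → BTy k
  | .unit => .unit
  | .sum b₁ b₂ => .sum b₁.strip b₂.strip
  | .prod b₁ b₂ => .prod b₁.strip b₂.strip
  | .list _ b => .list 0 b.strip

def ATy.strip {k : ℕ} : ATy k → ATy k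
  | .base b => .base b.strip
  | .fn 𝒯 => .fn 𝒯

/-- The sharing relation on annotated base types. -/
inductive BTy.Share {k : ℕ} : BTy k → BTy k → BTy k → Prop
  | unit : Share .unit .unit .unit
  | sum {a b a₁ b₁ a₂ b₂} (ha : Share a a₁ a₂) (hb : Share b b₁ b₂) :
      Share (.sum a b) (.sum a₁ b₁) (.sum a₂ b₂)
  | prod {a b a₁ b₁ a₂ b₂} (ha : Share a a₁ a₂) (hb : Share b b₁ b₂) :
      Share (.prod a b) (.prod a₁ b₁) (.prod a₂ b₂)
  | list {p p₁ p₂ b b₁ b₂} (hp : p = p₁ + p₂) (hb : Share b b₁ b₂) :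
      Share (.list p b) (.list p₁ b₁) (.list p₂ b₂)

/-- The sharing relation on annotated types; functions store no potential. -/
inductive ATy.Share {k : ℕ} : ATy k → ATy k → ATy k → Prop
  | base {b b₁ b₂} (h : BTy.Share b b₁ b₂) : Share (.base b) (.base b₁) (.base b₂)
  | fn {𝒯 𝒯₁ 𝒯₂} (h₁ : 𝒯₁ ⊆ 𝒯) (h₂ : 𝒯₂ ⊆ 𝒯) : Share (.fn 𝒯) (.fn 𝒯₁) (.fn 𝒯₂)

/-- Subtyping of annotated base types. -/
inductive BTy.Sub {k : ℕ} : BTy k → BTy k → Prop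
  | unit : Sub .unit .unit
  | sum {b₁ b₂ c₁ c₂} (h₁ : Sub b₁ c₁) (h₂ : Sub b₂ c₂) : Sub (.sum b₁ b₂) (.sum c₁ c₂)
  | prod {b₁ b₂ c₁ c₂} (h₁ : Sub b₁ c₁) (h₂ : Sub b₂ c₂) : Sub (.prod b₁ b₂) (.prod c₁ c₂)
  | list {p₁ p₂ b₁ b₂} (hp : p₁ ≥ p₂) (hb : Sub b₁ b₂) : Sub (.list p₁ b₁) (.list p₂ b₂)

/-- Subtyping of annotated arrow types: contravariant in the argument, covariant in the result,
where `⟨b₁, q₁⟩ <: ⟨b₂, q₂⟩` means `b₁ <: b₂` and `q₁ ≥ q₂`. -/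
def Arrow.Sub {k : ℕ} (A C : Arrow k) : Prop :=
  (C.dom.Sub A.dom ∧ C.domPot ≥ A.domPot) ∧ (A.cod.Sub C.cod ∧ A.codPot ≥ C.codPot)

inductive ATy.Sub {k : ℕ} : ATy k → ATy k → Prop
  | base {b₁ b₂} (h : BTy.Sub b₁ b₂) : Sub (.base b₁) (.base b₂)
  | fn {𝒯 𝒯'} (h : ∀ C ∈ 𝒯', ∃ A ∈ 𝒯, Arrow.Sub A C) : Sub (.fn 𝒯) (.fn 𝒯')

/-- Annotated typing contexts. -/
abbrev Ctx (k : ℕ) := ℕ → Option (ATy k)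

namespace Ctx

variable {k : ℕ}

def empty : Ctx k := fun _ => none

/-- The context `Γ, x : τ`; it hides an earlier variable of the same name. -/
def ext (Γ : Ctx k) (x : ℕ) (τ : ATy k) : Ctx k := Function.update Γ x (some τ)

def union (Γ₁ Γ₂ : Ctx k) : Ctx k := fun x => (Γ₁ x).or (Γ₂ x)

def Disj (Γ₁ Γ₂ : Ctx k) : Prop := ∀ x, Γ₁ x = none ∨ Γ₂ x = none

def Subset (Γ₁ Γ₂ : Ctx k) : Prop := ∀ x τ, Γ₁ x = some τ → Γ₂ x = some τ

def strip (Γ : Ctx k) : Ctx k := fun x => (Γ x).map ATy.strip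

end Ctx

/-- `HasType Adm Γ q e τ p` is the judgment `Γ; q ⊢ e : ⟨τ, p⟩` of univariate AARA for the tick
metric, with potential vectors of length `k`. Variables are affine. The parameter `Adm` says which
sets `𝒯` of arrow types the rule `func` may assign to a function definition: with no restriction
this is the full declarative system, with all its resource-polymorphic recursion. -/
inductive HasType {k : ℕ} (Adm : Set (Arrow k) → Prop) :
    Ctx k → ℚ≥0 → Expr → ATy k → ℚ≥0 → Prop
  | var {x τ} : HasType Adm (Ctx.empty.ext x τ) 0 (.var x) τ 0
  | unit : HasType Adm .empty 0 .unit (.base .unit) 0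
  | inl {Γ : Ctx k} {x b₁ b₂} (hx : HasType Adm Γ 0 (.var x) (.base b₁) 0) :
      HasType Adm Γ 0 (.inl x) (.base (.sum b₁ b₂)) 0
  | inr {Γ : Ctx k} {x b₁ b₂} (hx : HasType Adm Γ 0 (.var x) (.base b₂) 0) :
      HasType Adm Γ 0 (.inr x) (.base (.sum b₁ b₂)) 0
  | pair {x₁ x₂ b₁ b₂} (hne : x₁ ≠ x₂) :
      HasType Adm ((Ctx.empty.ext x₁ (.base b₁)).ext x₂ (.base b₂)) 0 (.pair x₁ x₂)
        (.base (.prod b₁ b₂)) 0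
  | nil {q : Pot k} {b} : HasType Adm .empty 0 .nil (.base (.list q b)) 0
  | cons {x₁ x₂} {q : Pot k} {b} (hne : x₁ ≠ x₂) :
      HasType Adm ((Ctx.empty.ext x₁ (.base b)).ext x₂ (.base (.list q.shift b))) q.head
        (.cons x₁ x₂) (.base (.list q b)) 0
  | func {Γ : Ctx k} {f x e} {𝒯 : Set (Arrow k)} (hΓ : Γ = Γ.strip) (h𝒯 : Adm 𝒯)
      (he : ∀ A ∈ 𝒯, HasType Adm ((Γ.strip.ext f (.fn 𝒯)).ext x (.base A.dom)) A.domPot e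
        (.base A.cod) A.codPot) :
      HasType Adm Γ 0 (.func f x e) (.fn 𝒯) 0
  | app {f x 𝒯} {A : Arrow k} (hne : f ≠ x) (hA : A ∈ 𝒯) :
      HasType Adm ((Ctx.empty.ext f (.fn 𝒯)).ext x (.base A.dom)) A.domPot (.app f x)
        (.base A.cod) A.codPot
  | caseSum {Γ : Ctx k} {x y el er b₁ b₂ q b p} (hx : Γ x = none)
      (hl : HasType Adm (Γ.ext y (.base b₁)) q el (.base b) p)
      (hr : HasType Adm (Γ.ext y (.base b₂)) q er (.base b) p) :
      HasType Adm (Γ.ext x (.base (.sum b₁ b₂))) q (.caseSum x y el er) (.base b) p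
  | casePair {Γ : Ctx k} {x x₁ x₂ e b₁ b₂ q b p} (hx : Γ x = none)
      (he : HasType Adm ((Γ.ext x₁ (.base b₁)).ext x₂ (.base b₂)) q e (.base b) p) :
      HasType Adm (Γ.ext x (.base (.prod b₁ b₂))) q (.casePair x x₁ x₂ e) (.base b) p
  | caseList {Γ : Ctx k} {x e₀ x₁ x₂ e₁} {r : Pot k} {b' q b p} (hx : Γ x = none)
      (h₀ : HasType Adm Γ q e₀ (.base b) p)
      (h₁ : HasType Adm ((Γ.ext x₁ (.base b')).ext x₂ (.base (.list r.shift b'))) (q + r.head)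
        e₁ (.base b) p) :
      HasType Adm (Γ.ext x (.base (.list r b'))) q (.caseList x e₀ x₁ x₂ e₁) (.base b) p
  | tick {c : ℚ} {q p : ℚ≥0} (h : (q : ℚ) = c + p) :
      HasType Adm .empty q (.tick c) (.base .unit) p
  | letE {Γ₁ Γ₂ : Ctx k} {x e₁ e₂ τ q p b p'} (hd : Ctx.Disj Γ₁ Γ₂)
      (h₁ : HasType Adm Γ₁ q e₁ τ p)
      (h₂ : HasType Adm (Γ₂.ext x τ) p e₂ (.base b) p') :
      HasType Adm (Γ₁.union Γ₂) q (.letE x e₁ e₂) (.base b) p'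
  | share {Γ : Ctx k} {x x₁ x₂ e τ τ₁ τ₂ q σ p} (hx : Γ x = none) (hτ : ATy.Share τ τ₁ τ₂)
      (he : HasType Adm ((Γ.ext x₁ τ₁).ext x₂ τ₂) q e σ p) :
      HasType Adm (Γ.ext x τ) q (.share x x₁ x₂ e) σ p
  | sub {Γ : Ctx k} {q e τ τ' p} (he : HasType Adm Γ q e τ p) (hτ : ATy.Sub τ τ') :
      HasType Adm Γ q e τ' p
  | sup {Γ : Ctx k} {x q e τ τ' σ p} (he : HasType Adm (Γ.ext x τ) q e σ p) (hτ : ATy.Sub τ' τ) :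
      HasType Adm (Γ.ext x τ') q e σ p
  | weak {Γ₁ Γ₂ : Ctx k} {q e τ p} (he : HasType Adm Γ₁ q e τ p) (hΓ : Ctx.Subset Γ₁ Γ₂) :
      HasType Adm Γ₂ q e τ p
  | relax {Γ : Ctx k} {p₁ p₂ q₁ q₂ : ℚ≥0} {e τ} (he : HasType Adm Γ p₁ e τ p₂) (h₁ : q₁ ≥ p₁)
      (h₂ : (q₁ : ℚ) - q₂ ≥ p₁ - p₂) :
      HasType Adm Γ q₁ e τ q₂

/-- Resource-monomorphic recursion: the set of arrow types of a function is a singleton. -/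
def Monomorphic {k : ℕ} (𝒯 : Set (Arrow k)) : Prop := ∃ A, 𝒯 = {A}

/-- Type inference with maximal degree `k` succeeds on the closed program `P` with the
annotated arrow type `A`: there is a derivation in which all potential vectors have length `k` and
all recursion is resource-monomorphic, that is, the finite system of linear constraints that
inference sets up for `P` in degree `k` is solvable. -/
def Infers (k : ℕ) (P : Expr) (A : Arrow k) : Prop :=
  HasType Monomorphic .empty 0 P (.fn {A}) 0

/-- The annotated type of bit strings, `L^q(1 + 1)`. -/
def BTy.bits {k : ℕ} (q : Pot k) : BTy k := .list q (.sum .unit .unit)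

end RaML

/-!
# Polynomial-time Turing machines in univariate AARA

The program runs the machine for a number of rounds that is fixed by the length `n` of the input
and bounded below by the running time; in the final state a round does nothing (`haltStep`), so the
surplus rounds are harmless. Only the round counter costs ticks, hence only the counter needs
potential, and all the data of the simulation are typed with zero potential. This leaves two things:
a counter that reaches every polynomial and is typable with resource-monomorphic recursion, and a
simulation of a single step.

The counter is a tower of clocks, one function definition for each degree. Write `S i n` for
`∑ j ≤ i, (n choose j)` (`binomSum`). The clock of degree `0` pays `C` ticks and performs `C`
rounds. On `(x :: xs, s)` the clock of degree `i + 1` calls the clock of degree `i` on `(xs, s)` and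
then itself on `xs` and the result; on `([], s)` it calls the clock of degree `i`. By Pascal's rule
`S (i + 1) (n + 1) = S i n + S (i + 1) n`, the clock of degree `i` performs `C * S i n` rounds and
costs exactly that much (`clockSuccBody_isClock`). It has the single arrow type with the vector
`(C, …, C, 0, …, 0)` of `i` entries `C` on the list and the constant potential `C`: for
degree `i + 1`, the additive shift of the vector is the sum of the vectors of degree `i` and `i + 1`,
and the first entry `C` pays for the second call (`clockSuccBody_hasType`). Each clock captures the
preceding one and is its only user, so the affine discipline asks for no sharing of functions.
Every polynomial is at most `C * S k n` for suitable `C` and `k` (`exists_eval_le_binomSum`), and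
`C * S k n` is the potential of the input of the whole program (`add_phi_clock`).

For the step, states and symbols are numbered, and numbers are lists of units, on which a finite case
distinction is a nest of list matches (`Expr.switch`). A configuration is the triple of the state,
the cells to the left of the head in reversed order, and the cells from the head on; cells beyond the
latter list are blank (`Represents`, `stepBody_simulates`). The recursive functions that build the
first tape and read off the output are cost-free.
-/

namespace RaML

/-! ### Derived typing rules

In these rules every variable is looked up in an arbitrary context, and what an expression uses up
is removed from the context by `Ctx.drop`. On concrete contexts the lookups hold by `rfl`. -/

variable {k : ℕ}

namespace Ctx

/-- The context `Γ` on the variables of the list `l` only. -/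
def restrict (Γ : Ctx k) (l : List ℕ) : Ctx k := fun y => if y ∈ l then Γ y else none

/-- The context `Γ` without the variables of the list `l`. -/
def drop (Γ : Ctx k) (l : List ℕ) : Ctx k := fun y => if y ∈ l then none else Γ y

theorem empty_subset (Γ : Ctx k) : Subset empty Γ := fun _ _ h => by simp [empty] at h

theorem ext_subset {Γ Δ : Ctx k} {x : ℕ} {τ : ATy k} (hx : Δ x = some τ) (h : Subset Γ Δ) :
    Subset (Γ.ext x τ) Δ := by
  intro y σ hy
  by_cases hyx : y = x
  · subst hyx
    simpa [ext, ← hx] using hy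
  · exact h y σ (by simpa [ext, hyx] using hy)

theorem drop_subset (Γ : Ctx k) (l : List ℕ) : Subset (Γ.drop l) Γ := by
  intro y σ hy
  by_cases h : y ∈ l <;> simp_all [drop]

theorem drop_self (Γ : Ctx k) (x : ℕ) : (Γ.drop [x]) x = none := by simp [drop]

theorem drop_ext {Γ : Ctx k} {x : ℕ} {τ : ATy k} (h : Γ x = some τ) :
    (Γ.drop [x]).ext x τ = Γ := by
  funext y
  by_cases hy : y = x
  · subst hy
    simp [ext, h]
  · simp [ext, drop, hy]

theorem restrict_union_drop (Γ : Ctx k) (l : List ℕ) :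
    (Γ.restrict l).union (Γ.drop l) = Γ := by
  funext y
  by_cases hy : y ∈ l <;> simp [union, restrict, drop, hy]

theorem disj_restrict_drop (Γ : Ctx k) (l : List ℕ) : Disj (Γ.restrict l) (Γ.drop l) := by
  intro y
  by_cases hy : y ∈ l <;> simp [restrict, drop, hy]

end Ctx

theorem Pot.shift_zero : (0 : Pot k).shift = 0 := by
  funext i
  simp [Pot.shift]

theorem Pot.head_zero : (0 : Pot k).head = 0 := by
  simp [Pot.head]

namespace HasType

variable {Adm : Set (Arrow k) → Prop} {Γ : Ctx k} {x y x₁ x₂ f : ℕ} {e e₀ e₁ e₂ el er : Expr}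
  {b b' b₁ b₂ : BTy k} {τ τ₁ τ₂ σ : ATy k} {q p p' c : ℚ≥0}

/-- Unused constant potential may be carried through. -/
theorem frame (h : HasType Adm Γ 0 e τ 0) : HasType Adm Γ p e τ p :=
  h.relax zero_le (by simp)

theorem var_of (h : Γ x = some τ) : HasType Adm Γ p (.var x) τ p :=
  (HasType.var.weak (Ctx.ext_subset h (Ctx.empty_subset Γ))).frame

theorem unit_of : HasType Adm Γ p .unit (.base .unit) p :=
  (HasType.unit.weak (Ctx.empty_subset Γ)).frame

theorem nil_of {r : Pot k} : HasType Adm Γ p .nil (.base (.list r b)) p :=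
  (HasType.nil.weak (Ctx.empty_subset Γ)).frame

theorem inl_of (h : Γ x = some (.base b₁)) :
    HasType Adm Γ p (.inl x) (.base (.sum b₁ b₂)) p :=
  (HasType.inl (var_of h)).frame

theorem inr_of (h : Γ x = some (.base b₂)) :
    HasType Adm Γ p (.inr x) (.base (.sum b₁ b₂)) p :=
  (HasType.inr (var_of h)).frame

theorem pair_of (h₁ : Γ x₁ = some (.base b₁)) (h₂ : Γ x₂ = some (.base b₂)) (hne : x₁ ≠ x₂) :
    HasType Adm Γ p (.pair x₁ x₂) (.base (.prod b₁ b₂)) p :=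
  ((HasType.pair hne).weak
    (Ctx.ext_subset h₂ (Ctx.ext_subset h₁ (Ctx.empty_subset Γ)))).frame

theorem cons_of (h₁ : Γ x₁ = some (.base b)) (h₂ : Γ x₂ = some (.base (.list 0 b)))
    (hne : x₁ ≠ x₂) : HasType Adm Γ p (.cons x₁ x₂) (.base (.list 0 b)) p := by
  have h := HasType.cons (Adm := Adm) (q := (0 : Pot k)) (b := b) hne
  rw [Pot.shift_zero, Pot.head_zero] at h
  exact (h.weak (Ctx.ext_subset h₂ (Ctx.ext_subset h₁ (Ctx.empty_subset Γ)))).frame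

theorem app_of (hf : Γ f = some (.fn {⟨b, c, b', 0⟩})) (hx : Γ x = some (.base b))
    (hne : f ≠ x) (hq : q = c + p) : HasType Adm Γ q (.app f x) (.base b') p := by
  have h := HasType.app (Adm := Adm) (A := ⟨b, c, b', 0⟩) hne (Set.mem_singleton _)
  refine (h.weak (Ctx.ext_subset hx (Ctx.ext_subset hf (Ctx.empty_subset Γ)))).relax ?_ ?_
  · simp [hq]
  · simp [hq]

theorem tick_of (c : ℕ) : HasType Adm Γ (c : ℚ≥0) (.tick (c : ℚ)) (.base .unit) 0 :=
  (HasType.tick (by simp)).weak (Ctx.empty_subset Γ)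

/-- A `let` whose bound expression uses up the variables of the list `l`. -/
theorem let_of (l : List ℕ) (h₁ : HasType Adm (Γ.restrict l) q e₁ τ p)
    (h₂ : HasType Adm ((Γ.drop l).ext x τ) p e₂ (.base b) p') :
    HasType Adm Γ q (.letE x e₁ e₂) (.base b) p' := by
  have h := HasType.letE (Ctx.disj_restrict_drop Γ l) h₁ h₂
  rwa [Ctx.restrict_union_drop] at h

theorem caseSum_of (hx : Γ x = some (.base (.sum b₁ b₂)))
    (hl : HasType Adm ((Γ.drop [x]).ext y (.base b₁)) q el (.base b) p)
    (hr : HasType Adm ((Γ.drop [x]).ext y (.base b₂)) q er (.base b) p) :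
    HasType Adm Γ q (.caseSum x y el er) (.base b) p := by
  have h := HasType.caseSum (Ctx.drop_self Γ x) hl hr
  rwa [Ctx.drop_ext hx] at h

theorem casePair_of (hx : Γ x = some (.base (.prod b₁ b₂)))
    (he : HasType Adm (((Γ.drop [x]).ext x₁ (.base b₁)).ext x₂ (.base b₂)) q e (.base b) p) :
    HasType Adm Γ q (.casePair x x₁ x₂ e) (.base b) p := by
  have h := HasType.casePair (Ctx.drop_self Γ x) he
  rwa [Ctx.drop_ext hx] at h

theorem caseList_of {r : Pot k} (hx : Γ x = some (.base (.list r b')))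
    (h₀ : HasType Adm (Γ.drop [x]) q e₀ (.base b) p)
    (h₁ : HasType Adm (((Γ.drop [x]).ext x₁ (.base b')).ext x₂ (.base (.list r.shift b')))
      (q + r.head) e₁ (.base b) p) :
    HasType Adm Γ q (.caseList x e₀ x₁ x₂ e₁) (.base b) p := by
  have h := HasType.caseList (Ctx.drop_self Γ x) h₀ h₁
  rwa [Ctx.drop_ext hx] at h

theorem caseList_zero (hx : Γ x = some (.base (.list 0 b')))
    (h₀ : HasType Adm (Γ.drop [x]) q e₀ (.base b) p)
    (h₁ : HasType Adm (((Γ.drop [x]).ext x₁ (.base b')).ext x₂ (.base (.list 0 b')))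
      q e₁ (.base b) p) :
    HasType Adm Γ q (.caseList x e₀ x₁ x₂ e₁) (.base b) p :=
  caseList_of hx h₀ (by rwa [Pot.shift_zero, Pot.head_zero, add_zero])

theorem share_of (hx : Γ x = some τ) (hτ : ATy.Share τ τ₁ τ₂)
    (he : HasType Adm (((Γ.drop [x]).ext x₁ τ₁).ext x₂ τ₂) q e σ p) :
    HasType Adm Γ q (.share x x₁ x₂ e) σ p := by
  have h := HasType.share (Ctx.drop_self Γ x) hτ he
  rwa [Ctx.drop_ext hx] at h

/-- The local definition of a closed function. -/
theorem letFun_closed {A : Arrow k} {z : ℕ}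
    (h₁ : HasType Monomorphic ((Ctx.empty.ext f (.fn {A})).ext x (.base A.dom)) A.domPot e₁
      (.base A.cod) A.codPot)
    (h₂ : HasType Monomorphic (Γ.ext z (.fn {A})) q e₂ (.base b) p) :
    HasType Monomorphic Γ q (.letE z (.func f x e₁) e₂) (.base b) p := by
  have hs : (Ctx.empty : Ctx k) = Ctx.empty.strip := rfl
  refine let_of [] (((HasType.func hs ⟨A, rfl⟩ ?_).weak (Ctx.empty_subset _)).frame) ?_
  · rintro _ rfl
    exact h₁
  · have hd : Γ.drop [] = Γ := by
      funext y
      simp [Ctx.drop]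
    rwa [hd]

/-- The local definition of a function that captures the function `g` and uses it up. -/
theorem letFun_capture {A : Arrow k} {𝒯 : Set (Arrow k)} {g z : ℕ} (hg : Γ g = some (.fn 𝒯))
    (h₁ : HasType Monomorphic (((Ctx.empty.ext g (.fn 𝒯)).ext f (.fn {A})).ext x (.base A.dom))
      A.domPot e₁ (.base A.cod) A.codPot)
    (h₂ : HasType Monomorphic ((Γ.drop [g]).ext z (.fn {A})) q e₂ (.base b) p) :
    HasType Monomorphic Γ q (.letE z (.func f x e₁) e₂) (.base b) p := by
  have hs : (Ctx.empty.ext g (.fn 𝒯) : Ctx k) = (Ctx.empty.ext g (.fn 𝒯)).strip := by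
    funext y
    by_cases hy : y = g
    · subst hy
      simp [Ctx.ext, Ctx.strip, ATy.strip]
    · simp [Ctx.ext, Ctx.strip, Ctx.empty, hy]
  refine let_of [g] (((HasType.func hs ⟨A, rfl⟩ ?_).weak
    (Ctx.ext_subset ?_ (Ctx.empty_subset _))).frame) h₂
  · rintro _ rfl
    rw [← hs]
    exact h₁
  · simp [Ctx.restrict, hg]

end HasType

/-! ### Derived evaluation rules -/

/-- Applied to the value `a`, the function value `F` returns `r` at cost `c`. -/
def Val.Computes (F a r : Val) (c : ℚ) : Prop :=
  ∀ (V : Env) (f x : ℕ), V f = some F → V x = some a → Eval V (.app f x) r c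

theorem Val.Computes.intro {U : Env} {f x : ℕ} {e : Expr} {a r : Val} {c : ℚ}
    (h : Eval ((U.ext f (.closure U f x e)).ext x a) e r c) :
    (Val.closure U f x e).Computes a r c :=
  fun _ _ _ hf hx => .app hf hx h

theorem Eval.let_zero {V : Env} {x : ℕ} {e₁ e₂ : Expr} {v₁ v : Val} {c : ℚ}
    (h₁ : Eval V e₁ v₁ 0) (h₂ : Eval (V.ext x v₁) e₂ v c) : Eval V (.letE x e₁ e₂) v c := by
  simpa using Eval.letE h₁ h₂

theorem Eval.let_of_zero {V : Env} {x : ℕ} {e₁ e₂ : Expr} {v₁ v : Val} {c : ℚ}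
    (h₁ : Eval V e₁ v₁ c) (h₂ : Eval (V.ext x v₁) e₂ v 0) : Eval V (.letE x e₁ e₂) v c := by
  simpa using Eval.letE h₁ h₂

/-! ### Finite data -/

/-- Numbers are represented by lists of units without potential. -/
abbrev BTy.num : BTy k := .list 0 .unit

/-- The number `n` as a list of `n` units. -/
def Val.num : ℕ → Val
  | 0 => .nil
  | n + 1 => .cons .unit (.num n)

/-- An expression for the number `n`. -/
def Expr.num : ℕ → Expr
  | 0 => .nil
  | n + 1 => .letE 0 (.num n) (.letE 1 .unit (.cons 1 0))

theorem Expr.num_hasType {Adm : Set (Arrow k) → Prop} {Γ : Ctx k} {p : ℚ≥0} (n : ℕ) :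
    HasType Adm Γ p (.num n) (.base .num) p := by
  refine HasType.weak (Γ₁ := Ctx.empty) ?_ (Ctx.empty_subset Γ)
  induction n with
  | zero => exact .nil_of
  | succ n ih =>
    exact .let_of [] ih (.let_of [] .unit_of (.cons_of rfl rfl (by decide)))

theorem Expr.num_eval (V : Env) (n : ℕ) : Eval V (.num n) (.num n) 0 := by
  induction n generalizing V with
  | zero => exact .nil
  | succ n ih =>
    exact .let_zero (ih V) (.let_zero .unit (.cons (by simp [Env.ext]) (by simp [Env.ext])))

/-- The case distinction on the value `0, …, m` of the number `x`, with the branches `F 0, …, F m`;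
larger numbers are treated as `m`. Each match binds the head and then the tail to `x` itself, so that
all branches are typed in the same context, without `x`. -/
def Expr.switch (x : ℕ) : ℕ → (ℕ → Expr) → Expr
  | 0, F => F 0
  | m + 1, F => .caseList x (F 0) x x (Expr.switch x m fun i => F (i + 1))

theorem Expr.switch_hasType {Adm : Set (Arrow k) → Prop} {Γ : Ctx k} {x : ℕ} {b : BTy k}
    {q p : ℚ≥0} (m : ℕ) (F : ℕ → Expr) (hx : Γ x = some (.base .num))
    (hF : ∀ i, HasType Adm (Γ.drop [x]) q (F i) (.base b) p) :
    HasType Adm Γ q (.switch x m F) (.base b) p := by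
  induction m generalizing Γ F with
  | zero => exact (hF 0).weak (Ctx.drop_subset _ _)
  | succ m ih =>
    refine .caseList_zero hx (hF 0) (ih _ (by simp [Ctx.ext]) fun i => ?_)
    convert hF (i + 1) using 1
    funext y
    by_cases hy : y = x <;> simp [Ctx.drop, Ctx.ext, hy]

/-- The switched variable is changed by the case distinction, the others are not. -/
theorem Expr.switch_eval {V : Env} {x i m : ℕ} {F : ℕ → Expr} {v : Val} {c : ℚ}
    (hx : V x = some (.num i)) (hi : i ≤ m)
    (hF : ∀ V' : Env, (∀ y, y ≠ x → V' y = V y) → Eval V' (F i) v c) :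
    Eval V (.switch x m F) v c := by
  induction m generalizing V F i with
  | zero =>
    obtain rfl : i = 0 := by omega
    exact hF V fun _ _ => rfl
  | succ m ih =>
    cases i with
    | zero => exact .caseNil hx (hF V fun _ _ => rfl)
    | succ i =>
      refine .caseCons hx (ih (i := i) (by simp [Env.ext]) (by omega) fun V' hV' => hF V' ?_)
      intro y hy
      rw [hV' y hy]
      simp [Env.ext, hy]

/-- A numbering of a finite type: `enc` takes values up to `bound`, and `dec` inverts it. -/
structure Coding (α : Type*) where
  enc : α → ℕ
  dec : ℕ → α
  bound : ℕ
  dec_enc : ∀ a, dec (enc a) = a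
  enc_le : ∀ a, enc a ≤ bound

theorem Coding.nonempty (α : Type*) [Finite α] (a₀ : α) : Nonempty (Coding α) := by
  let e := Finite.equivFin α
  exact ⟨{ enc := fun a => e a
           dec := fun i => if h : i < Nat.card α then e.symm ⟨i, h⟩ else a₀
           bound := Nat.card α
           dec_enc := fun a => by simp
           enc_le := fun a => (e a).2.le }⟩

/-! ### The program -/

section Program

variable {k : ℕ}

/-- Tapes are represented by lists of numbers without potential. -/
abbrev BTy.stack : BTy k := .list 0 .num

/-- Configurations are represented by `(q, (l, r))`: the state, the cells to the left of the head
in reversed order, and the cells from the head on. -/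
abbrev BTy.cfg : BTy k := .prod .num (.prod .stack .stack)

/-- The type of a bit. -/
abbrev BTy.bit : BTy k := .sum .unit .unit

/-- The arrow type `⟨b, c⟩ → ⟨b', 0⟩`. -/
abbrev Arrow.of (b : BTy k) (c : ℚ≥0) (b' : BTy k) : Arrow k := ⟨b, c, b', 0⟩

/-- The context of the body of a closed function, with name `4` and argument `5`. -/
abbrev Ctx.body (A : Arrow k) : Ctx k :=
  (Ctx.empty.ext 4 (.fn {A})).ext 5 (.base A.dom)

/-- The context of the body of a function, with name `4` and argument `5`, that captures the
function `3`. -/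
abbrev Ctx.body₃ (A₃ A : Arrow k) : Ctx k :=
  ((Ctx.empty.ext 3 (.fn {A₃})).ext 4 (.fn {A})).ext 5 (.base A.dom)

/-- The body of the function that turns a bit string into a tape segment, where `n b` is the number
of the bit `b`. -/
def convBody (n : Bool → ℕ) : Expr :=
  .caseList 5 .nil 6 5 <| .letE 5 (.app 4 5) <| .caseSum 6 7
    (.letE 6 (.num (n false)) (.cons 6 5)) (.letE 6 (.num (n true)) (.cons 6 5))

theorem convBody_hasType (n : Bool → ℕ) :
    HasType Monomorphic (Ctx.body (k := k) (.of (.bits 0) 0 .stack)) 0 (convBody n)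
      (.base .stack) 0 := by
  refine .caseList_zero rfl .nil_of ?_
  refine .let_of [4, 5] (.app_of rfl rfl (by decide) (add_zero 0).symm) ?_
  refine .caseSum_of rfl ?_ ?_ <;>
  exact .let_of [] (Expr.num_hasType _) (.cons_of rfl rfl (by decide))

/-- The body of the function `(l, r) ↦ l.reverse ++ r`. -/
def revBody : Expr :=
  .casePair 5 6 7 <| .caseList 6 (.var 7) 8 6 <|
    .letE 7 (.cons 8 7) <| .letE 5 (.pair 6 7) <| .app 4 5

theorem revBody_hasType :
    HasType Monomorphic (Ctx.body (k := k) (.of (.prod .stack .stack) 0 .stack)) 0 revBody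
      (.base .stack) 0 := by
  refine .casePair_of rfl (.caseList_zero rfl (.var_of rfl) ?_)
  refine .let_of [8, 7] (.cons_of rfl rfl (by decide)) ?_
  refine .let_of [6, 7] (.pair_of rfl rfl (by decide)) ?_
  exact .app_of rfl rfl (by decide) (add_zero 0).symm

/-- The body of the function that turns a tape segment into a bit string, up to the first symbol
that is not a bit; `d i` is the bit with number `i`, if there is one, and the numbers are at
most `m`. -/
def outBody (m : ℕ) (d : ℕ → Option Bool) : Expr :=
  .caseList 5 .nil 6 5 <| .switch 6 m fun i => match d i with
    | none => .nil
    | some false =>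
      .letE 6 .unit <| .letE 6 (.inl 6) <| .letE 5 (.app 4 5) <| .cons 6 5
    | some true =>
      .letE 6 .unit <| .letE 6 (.inr 6) <| .letE 5 (.app 4 5) <| .cons 6 5

theorem outBody_hasType (m : ℕ) (d : ℕ → Option Bool) :
    HasType Monomorphic (Ctx.body (k := k) (.of .stack 0 (.bits 0))) 0 (outBody m d)
      (.base (.bits 0)) 0 := by
  refine .caseList_zero rfl .nil_of (Expr.switch_hasType m _ rfl fun i => ?_)
  split
  · exact .nil_of
  · refine .let_of [] .unit_of (.let_of [6] (.inl_of (b₂ := .unit) rfl) ?_)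
    refine .let_of [4, 5] (.app_of rfl rfl (by decide) (add_zero 0).symm) ?_
    exact .cons_of rfl rfl (by decide)
  · refine .let_of [] .unit_of (.let_of [6] (.inr_of (b₁ := .unit) rfl) ?_)
    refine .let_of [4, 5] (.app_of rfl rfl (by decide) (add_zero 0).symm) ?_
    exact .cons_of rfl rfl (by decide)

/-- The configuration with state number `q` and the tape segments in the variables `8`, `9`. -/
def cfgExpr (q : ℕ) : Expr :=
  .letE 6 (.num q) <| .letE 7 (.pair 8 9) <| .pair 6 7

theorem cfgExpr_hasType {Adm : Set (Arrow k) → Prop} {Γ : Ctx k} {p : ℚ≥0} (q : ℕ)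
    (h₈ : Γ 8 = some (.base .stack)) (h₉ : Γ 9 = some (.base .stack)) :
    HasType Adm Γ p (cfgExpr q) (.base .cfg) p := by
  refine .let_of [] (Expr.num_hasType q) ?_
  refine .let_of [8, 9] (.pair_of (b₁ := .stack) (b₂ := .stack) ?_ ?_ (by decide))
    (.pair_of ?_ ?_ (by decide)) <;>
  simp [Ctx.restrict, Ctx.drop, Ctx.ext, h₈, h₉]

/-- The effect of a transition to the state number `q` that writes the symbol number `a` and moves
in the direction `d`: the variable `8` holds the cells to the left of the head, and `9` those to
its right. -/
def moveExpr (q a : ℕ) : Dir → Expr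
  | .R => .letE 10 (.num a) <| .letE 8 (.cons 10 8) <| cfgExpr q
  | .L => .letE 10 (.num a) <| .letE 9 (.cons 10 9) <|
      .caseList 8 (.letE 8 .nil (cfgExpr q)) 10 8 (.letE 9 (.cons 10 9) (cfgExpr q))

theorem moveExpr_hasType {Adm : Set (Arrow k) → Prop} {Γ : Ctx k} {p : ℚ≥0} (q a : ℕ) (d : Dir)
    (h₈ : Γ 8 = some (.base .stack)) (h₉ : Γ 9 = some (.base .stack)) :
    HasType Adm Γ p (moveExpr q a d) (.base .cfg) p := by
  have hsub : Ctx.Subset ((Ctx.empty.ext 8 (.base .stack)).ext 9 (.base .stack)) Γ :=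
    Ctx.ext_subset h₉ (Ctx.ext_subset h₈ (Ctx.empty_subset Γ))
  refine HasType.weak ?_ hsub
  cases d with
  | R =>
    refine .let_of [] (Expr.num_hasType a) ?_
    exact .let_of [10, 8] (.cons_of rfl rfl (by decide)) (cfgExpr_hasType q rfl rfl)
  | L =>
    refine .let_of [] (Expr.num_hasType a) ?_
    refine .let_of [10, 9] (.cons_of rfl rfl (by decide)) (.caseList_zero rfl ?_ ?_)
    · exact .let_of [] .nil_of (cfgExpr_hasType q rfl rfl)
    · exact .let_of [10, 9] (.cons_of rfl rfl (by decide)) (cfgExpr_hasType q rfl rfl)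

/-- The body of the function that iterates the function `3` on the second component of the
argument, as often as the first component says. -/
def iterBody : Expr :=
  .casePair 5 6 7 <| .caseList 6 (.var 7) 8 6 <|
    .letE 7 (.app 3 7) <| .letE 5 (.pair 6 7) <| .app 4 5

theorem iterBody_hasType (b : BTy k) :
    HasType Monomorphic (Ctx.body₃ (.of b 0 b) (.of (.prod .num b) 0 b)) 0 iterBody
      (.base b) 0 := by
  refine .casePair_of rfl (.caseList_zero rfl (.var_of rfl) ?_)
  refine .let_of [3, 7] (.app_of rfl rfl (by decide) (add_zero 0).symm) ?_
  refine .let_of [6, 7] (.pair_of rfl rfl (by decide)) ?_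
  exact .app_of rfl rfl (by decide) (add_zero 0).symm

/-- The body of the clock of degree `0`: it ignores the list in the argument, pays `C` ticks and
calls the iterator `3` for `C` rounds. -/
def clockZeroBody (C : ℕ) : Expr :=
  .casePair 5 6 7 <| .letE 8 (.tick C) <| .letE 6 (.num C) <| .letE 5 (.pair 6 7) <| .app 3 5

theorem clockZeroBody_hasType (C : ℕ) (b b' : BTy k) :
    HasType Monomorphic (Ctx.body₃ (.of (.prod .num b) 0 b) (.of (.prod b' b) C b)) C
      (clockZeroBody C) (.base b) 0 := by
  refine .casePair_of rfl (.let_of [] (.tick_of C) (.let_of [] (Expr.num_hasType C) ?_))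
  refine .let_of [6, 7] (.pair_of rfl rfl (by decide)) ?_
  exact .app_of rfl rfl (by decide) (add_zero 0).symm

/-- The body of the clock of degree `i + 1`, which captures the clock of degree `i` as `3`: on
`(x :: xs, s)` it runs the clock of degree `i` on `(xs, s)`, and then itself on `xs` and the
result. -/
def clockSuccBody : Expr :=
  .casePair 5 6 7 <| .caseList 6 (.letE 6 .nil <| .letE 5 (.pair 6 7) <| .app 3 5) 8 6 <|
    .share 6 6 9 <| .letE 5 (.pair 6 7) <| .letE 7 (.app 3 5) <| .letE 5 (.pair 9 7) <| .app 4 5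

/-- The potential of the list in the argument of the clock of degree `i`: the first `i` components
are `C`. -/
def Pot.clock (k C i : ℕ) : Pot k := fun j => if (j : ℕ) < i then C else 0

theorem Pot.clock_succ_shift {C i : ℕ} (hi : i + 1 ≤ k) :
    (Pot.clock k C (i + 1)).shift = Pot.clock k C i + Pot.clock k C (i + 1) := by
  funext j
  have hj := j.2
  simp only [Pot.shift, Pot.clock, Pi.add_apply]
  by_cases h : (j : ℕ) < i
  · have h₁ : (j : ℕ) + 1 < k := by omega
    simp [h, h₁, Nat.lt_succ_of_lt h]
  · simp [h]

theorem Pot.clock_succ_head {C i : ℕ} (hi : i + 1 ≤ k) : (Pot.clock k C (i + 1)).head = C := by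
  have hk : 0 < k := by omega
  simp [Pot.head, Pot.clock, hk]

/-- The arrow type of the clock of degree `i`. -/
abbrev Arrow.clock (k C i : ℕ) (b : BTy k) : Arrow k :=
  .of (.prod (.bits (Pot.clock k C i)) b) C b

/-- The shifted potential of the tail, which splits by `Pot.clock_succ_shift`, pays for the calls of
both clocks. -/
theorem clockSuccBody_hasType {C i : ℕ} (hi : i + 1 ≤ k) (b : BTy k) :
    HasType Monomorphic (Ctx.body₃ (.clock k C i b) (.clock k C (i + 1) b)) C clockSuccBody
      (.base b) 0 := by
  refine .casePair_of rfl (.caseList_of rfl ?_ ?_)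
  · refine .let_of [] (.nil_of (r := Pot.clock k C i) (b := .bit)) ?_
    refine .let_of [6, 7] (.pair_of rfl rfl (by decide)) ?_
    exact .app_of rfl rfl (by decide) (add_zero _).symm
  · rw [Pot.clock_succ_shift hi, Pot.clock_succ_head hi]
    refine .share_of rfl (.base (.list rfl (.sum .unit .unit))) ?_
    refine .let_of [6, 7] (.pair_of rfl rfl (by decide)) ?_
    -- One of the two `C` pays for this call, the other one for the recursive call.
    refine .let_of [3, 5] (.app_of (p := C) rfl rfl (by decide) rfl) ?_
    refine .let_of [9, 7] (.pair_of rfl rfl (by decide)) ?_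
    exact .app_of rfl rfl (by decide) (add_zero _).symm

/-- The definition of `k` further clocks on top of the clock `3`, in the program `e`. -/
def clocks : ℕ → Expr → Expr
  | 0, e => e
  | k + 1, e => .letE 3 (.func 4 5 clockSuccBody) (clocks k e)

theorem clocks_hasType {C i n : ℕ} (hi : i + n ≤ k) (b b' : BTy k) (r : Pot k) {q p : ℚ≥0}
    {e : Expr}
    (he : HasType Monomorphic ((Ctx.empty.ext 1 (.base (.bits r))).ext 3
      (.fn {.clock k C (i + n) b})) q e (.base b') p) :
    HasType Monomorphic ((Ctx.empty.ext 1 (.base (.bits r))).ext 3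
      (.fn {.clock k C i b})) q (clocks n e) (.base b') p := by
  induction n generalizing i with
  | zero => exact he
  | succ n ih =>
    refine .letFun_capture rfl (clockSuccBody_hasType (by omega) b) ?_
    refine (ih (i := i + 1) (by omega) (by rwa [add_assoc, add_comm 1])).weak ?_
    exact Ctx.ext_subset rfl (Ctx.ext_subset rfl (Ctx.empty_subset _))

end Program

/-! ### The program for a Turing machine -/

section Machine

open TuringMachine

variable {Q Γ : Type*} (M : TuringMachine Q Γ) (cQ : Coding Q) (cΓ : Coding Γ)

open scoped Classical in
/-- The code for the transition from the state `q` on the symbol `a`. The final state is never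
left: there the configuration is kept as it is. -/
noncomputable def stepBody : Expr :=
  .casePair 5 6 7 <| .casePair 7 8 9 <| .switch 6 cQ.bound fun i =>
    if cQ.dec i = M.qFinal then cfgExpr i else
    let act (a : Γ) : Expr :=
      let r := M.δ (cQ.dec i, a)
      moveExpr (cQ.enc r.1) (cΓ.enc r.2.1) r.2.2
    .caseList 9 (.letE 9 .nil (act M.blank)) 7 9 <| .switch 7 cΓ.bound fun j => act (cΓ.dec j)

theorem stepBody_hasType {k : ℕ} :
    HasType Monomorphic (Ctx.body (k := k) (.of .cfg 0 .cfg)) 0 (stepBody M cQ cΓ)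
      (.base .cfg) 0 := by
  refine .casePair_of rfl (.casePair_of rfl (Expr.switch_hasType _ _ rfl fun i => ?_))
  split
  · exact cfgExpr_hasType i rfl rfl
  · refine .caseList_zero rfl (.let_of [] .nil_of (moveExpr_hasType _ _ _ rfl rfl)) ?_
    exact Expr.switch_hasType _ _ rfl fun j => moveExpr_hasType _ _ _ rfl rfl

open scoped Classical in
/-- The bit with the number `i`, if there is one. -/
noncomputable def bitOf (i : ℕ) : Option Bool :=
  if cΓ.dec i = M.bit false then some false
  else if cΓ.dec i = M.bit true then some true
  else none

/-- The program once the clock of the needed degree is available as `3`: it builds the initial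
configuration on the input `1`, runs the clock, and reads off the output. -/
noncomputable def mainExpr : Expr :=
  .share 1 1 2 <|
  .letE 6 (.func 4 5 (convBody fun b => cΓ.enc (M.bit b))) <|
  .letE 9 (.app 6 2) <|
  .letE 8 .nil <|
  .letE 10 (.num (cΓ.enc M.leftEnd)) <|
  .letE 8 (.cons 10 8) <|
  .letE 7 (cfgExpr (cQ.enc M.q₀)) <|
  .letE 5 (.pair 1 7) <|
  .letE 5 (.app 3 5) <|
  .casePair 5 6 7 <|
  .letE 6 (.func 4 5 revBody) <|
  .letE 5 (.app 6 7) <|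
  .caseList 5 .nil 6 5 <|
  .letE 6 (.func 4 5 (outBody cΓ.bound (bitOf M cΓ))) <|
  .app 6 5

theorem mainExpr_hasType {k : ℕ} (C : ℕ) :
    HasType Monomorphic ((Ctx.empty.ext 1 (.base (.bits (Pot.clock k C k)))).ext 3
      (.fn {.clock k C k .cfg})) C (mainExpr M cQ cΓ) (.base (.bits 0)) 0 := by
  refine .share_of rfl (.base (.list (add_zero _).symm (.sum .unit .unit))) ?_
  refine .letFun_closed (A := .of (.bits 0) 0 .stack) (convBody_hasType _) ?_
  refine .let_of [6, 2] (.app_of rfl rfl (by decide) (zero_add _).symm) ?_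
  refine .let_of [] (.nil_of (r := 0) (b := .num)) (.let_of [] (Expr.num_hasType _) ?_)
  refine .let_of [10, 8] (.cons_of (b := .num) rfl rfl (by decide)) ?_
  refine .let_of [8, 9] (cfgExpr_hasType _ rfl rfl) ?_
  refine .let_of [1, 7] (.pair_of rfl rfl (by decide)) ?_
  refine .let_of [3, 5] (.app_of rfl rfl (by decide) (add_zero _).symm) ?_
  refine .casePair_of rfl (.letFun_closed (A := .of (.prod .stack .stack) 0 .stack)
    revBody_hasType ?_)
  refine .let_of [6, 7] (.app_of rfl rfl (by decide) (add_zero _).symm) ?_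
  refine .caseList_zero rfl .nil_of ?_
  refine .letFun_closed (A := .of .stack 0 (.bits 0)) (outBody_hasType _ _) ?_
  exact .app_of rfl rfl (by decide) (add_zero _).symm

/-- The program that simulates `M` for `C * ∑ i ≤ k, (n choose i)` rounds on inputs of
length `n`. -/
noncomputable def simulator (C k : ℕ) : Expr :=
  .func 0 1 <|
  .letE 3 (.func 4 5 (stepBody M cQ cΓ)) <|
  .letE 3 (.func 4 5 iterBody) <|
  .letE 3 (.func 4 5 (clockZeroBody C)) <|
  clocks k (mainExpr M cQ cΓ)

theorem simulator_infers (C k : ℕ) :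
    Infers k (simulator M cQ cΓ C k)
      ⟨.bits (Pot.clock k C k), C, .bits 0, 0⟩ := by
  refine .func rfl ⟨_, rfl⟩ ?_
  rintro _ rfl
  refine .letFun_closed (A := .of .cfg 0 .cfg) (stepBody_hasType M cQ cΓ) ?_
  refine .letFun_capture (A := .of (.prod .num .cfg) 0 .cfg) rfl (iterBody_hasType _) ?_
  refine .letFun_capture (A := .clock k C 0 .cfg) rfl (clockZeroBody_hasType C _ _) ?_
  have h := clocks_hasType (i := 0) (n := k) (C := C) (by omega) .cfg (.bits 0)
    (Pot.clock k C k) (by rw [zero_add]; exact mainExpr_hasType M cQ cΓ C)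
  exact h.weak (Ctx.ext_subset rfl (Ctx.ext_subset rfl (Ctx.empty_subset _)))

end Machine

/-! ### Evaluation of the parts of the program -/

section Simulation

/-- A list of numbers as a value. -/
def Val.stack : List ℕ → Val
  | [] => .nil
  | a :: l => .cons (.num a) (.stack l)

/-- The value `(q, (l, r))`. -/
def Val.cfg (q : ℕ) (l r : List ℕ) : Val := .pair (.num q) (.pair (.stack l) (.stack r))

theorem convBody_computes (U : Env) (n : Bool → ℕ) (w : List Bool) :
    (Val.closure U 4 5 (convBody n)).Computes (.ofBits w) (.stack (w.map n)) 0 := by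
  induction w with
  | nil => exact .intro (.caseNil rfl .nil)
  | cons b w ih =>
    refine .intro (.caseCons rfl ?_)
    refine .let_zero (ih _ _ _ rfl rfl) ?_
    cases b with
    | false =>
      refine .caseInl (v := .unit) rfl ?_
      exact .let_zero (Expr.num_eval _ _) (.cons rfl rfl)
    | true =>
      refine .caseInr (v := .unit) rfl ?_
      exact .let_zero (Expr.num_eval _ _) (.cons rfl rfl)

theorem revBody_computes (U : Env) (l r : List ℕ) :
    (Val.closure U 4 5 revBody).Computes (.pair (.stack l) (.stack r))
      (.stack (l.reverse ++ r)) 0 := by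
  induction l generalizing r with
  | nil =>
    refine .intro (.casePair (v₁ := .stack []) (v₂ := .stack r) rfl ?_)
    exact .caseNil rfl (.var rfl)
  | cons a l ih =>
    refine .intro (.casePair (v₁ := .stack (a :: l)) (v₂ := .stack r) rfl ?_)
    refine .caseCons (v₁ := .num a) (v₂ := .stack l) rfl ?_
    refine .let_zero (v₁ := .stack (a :: r)) (.cons rfl rfl) ?_
    refine .let_zero (.pair (v₁ := .stack l) (v₂ := .stack (a :: r)) rfl
      rfl) ?_
    rw [List.reverse_cons, List.append_assoc]
    exact ih (a :: r) _ _ _ rfl rfl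

theorem cfgExpr_eval {V : Env} (q : ℕ) {l r : List ℕ} (hl : V 8 = some (.stack l))
    (hr : V 9 = some (.stack r)) : Eval V (cfgExpr q) (.cfg q l r) 0 := by
  refine .let_zero (Expr.num_eval _ _) ?_
  refine .let_zero (.pair (v₁ := .stack l) (v₂ := .stack r) hl
    hr) ?_
  exact .pair rfl rfl

/-- The cells to the left of the head (in reversed order) and from the head on, after the symbol
`b` has been written between `l` and `r` and the head has moved from there. -/
def moveTape {α : Type*} : Dir → α → List α → List α → List α × List α
  | .R, b, l, r => (b :: l, r)
  | .L, b, [], r => ([], b :: r)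
  | .L, b, a :: l, r => (l, a :: b :: r)

theorem moveTape_append {α : Type*} (d : Dir) (b : α) (l r : List α) :
    (moveTape d b l r).1.reverse ++ (moveTape d b l r).2 = l.reverse ++ b :: r := by
  cases d <;> cases l <;> simp [moveTape]

theorem moveTape_length {α : Type*} (d : Dir) (b : α) (l r : List α) :
    (moveTape d b l r).1.length = TuringMachine.moveHead d l.length := by
  cases d <;> cases l <;> simp [moveTape, TuringMachine.moveHead]

theorem moveExpr_eval {α : Type*} (n : α → ℕ) {V : Env} (q : ℕ) (a : α) (d : Dir)
    {l r : List α} (hl : V 8 = some (.stack (l.map n))) (hr : V 9 = some (.stack (r.map n))) :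
    Eval V (moveExpr q (n a) d)
      (.cfg q ((moveTape d a l r).1.map n) ((moveTape d a l r).2.map n)) 0 := by
  cases d with
  | R =>
    refine .let_zero (Expr.num_eval _ _) ?_
    refine .let_zero (v₁ := .stack ((a :: l).map n)) (.cons rfl
      hl) ?_
    exact cfgExpr_eval _ (by simp [Env.ext, moveTape]) (by simp [Env.ext, moveTape, hr])
  | L =>
    refine .let_zero (Expr.num_eval _ _) ?_
    refine .let_zero (v₁ := .stack ((a :: r).map n)) (.cons rfl
      hr) ?_
    cases l with
    | nil =>
      refine .caseNil (by simp [Env.ext, hl, Val.stack]) (.let_zero .nil ?_)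
      exact cfgExpr_eval _ (by simp [Env.ext, moveTape, Val.stack]) (by simp [Env.ext, moveTape])
    | cons c l =>
      refine .caseCons (v₁ := .num (n c)) (v₂ := .stack (l.map n))
        (by simp [Env.ext, hl, Val.stack]) ?_
      refine .let_zero (v₁ := .stack ((c :: a :: r).map n)) (.cons rfl
        rfl) ?_
      exact cfgExpr_eval _ (by simp [Env.ext, moveTape]) (by simp [Env.ext, moveTape])

/-- If the value `v` represents `a` in the sense of `R`, then the function value `F`, applied to
`g v`, returns a representation of `s a`, at cost `c`. -/
def Simulates {α : Type*} (R : Val → α → Prop) (F : Val) (g : Val → Val) (s : α → α)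
    (c : ℚ) : Prop :=
  ∀ v a, R v a → ∃ v', R v' (s a) ∧ F.Computes (g v) v' c

variable {α : Type*} {R : Val → α → Prop} {s : α → α}

theorem iterBody_simulates {U : Env} {F : Val} (hU : U 3 = some F) (hF : Simulates R F id s 0)
    (m : ℕ) : Simulates R (.closure U 4 5 iterBody) (.pair (.num m)) s^[m] 0 := by
  induction m with
  | zero =>
    intro v a hv
    refine ⟨v, hv, .intro (.casePair (v₁ := .num 0) (v₂ := v) rfl ?_)⟩
    exact .caseNil rfl (.var rfl)
  | succ m ih =>
    intro v a hv
    obtain ⟨v₁, hv₁, h₁⟩ := hF v a hv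
    obtain ⟨v₂, hv₂, h₂⟩ := ih v₁ (s a) hv₁
    refine ⟨v₂, hv₂, .intro (.casePair (v₁ := .num (m + 1)) (v₂ := v) rfl ?_)⟩
    refine .caseCons (v₁ := .unit) (v₂ := .num m) rfl ?_
    refine .let_zero (h₁ _ _ _ hU rfl) ?_
    refine .let_zero (.pair (v₁ := .num m) (v₂ := v₁) rfl rfl) ?_
    exact h₂ _ _ _ rfl rfl

/-- The sum of the binomial coefficients `n choose j` for `j ≤ i`. -/
def binomSum (i n : ℕ) : ℕ := ∑ j ∈ Finset.range (i + 1), n.choose j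

theorem binomSum_zero (n : ℕ) : binomSum 0 n = 1 := by simp [binomSum]

theorem binomSum_nil (i : ℕ) : binomSum i 0 = 1 := by
  simp [binomSum, Finset.sum_range_succ']

/-- Pascal's rule, which is the recursion of the clocks. -/
theorem binomSum_succ_succ (i n : ℕ) :
    binomSum (i + 1) (n + 1) = binomSum i n + binomSum (i + 1) n := by
  rw [binomSum, Finset.sum_range_succ']
  simp only [Nat.choose_succ_succ, Finset.sum_add_distrib]
  rw [binomSum, binomSum, Finset.sum_range_succ' _ (i + 1)]
  simp [add_assoc]

/-- The function value `F` is a clock of degree `i` for `s`: on a bit string of length `n` and a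
representation it carries out `C * binomSum i n` rounds, at a cost of one for each round. -/
def IsClock (R : Val → α → Prop) (s : α → α) (C i : ℕ) (F : Val) : Prop :=
  ∀ w : List Bool, Simulates R F (.pair (.ofBits w)) s^[C * binomSum i w.length]
    (C * binomSum i w.length : ℕ)

theorem clockZeroBody_isClock {U : Env} {F : Val} {C : ℕ} (hU : U 3 = some F)
    (hF : Simulates R F (.pair (.num C)) s^[C] 0) :
    IsClock R s C 0 (.closure U 4 5 (clockZeroBody C)) := by
  intro w v a hv
  obtain ⟨v', hv', h⟩ := hF v a hv
  rw [binomSum_zero, mul_one]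
  refine ⟨v', hv', .intro (.casePair (v₁ := .ofBits w) (v₂ := v) rfl ?_)⟩
  refine .let_of_zero .tick (.let_zero (Expr.num_eval _ _) ?_)
  refine .let_zero (.pair (v₁ := .num C) (v₂ := v) rfl rfl) ?_
  exact h _ _ _ hU rfl

theorem clockSuccBody_isClock {U : Env} {F : Val} {C i : ℕ} (hU : U 3 = some F)
    (hF : IsClock R s C i F) : IsClock R s C (i + 1) (.closure U 4 5 clockSuccBody) := by
  intro w
  induction w with
  | nil =>
    intro v a hv
    obtain ⟨v', hv', h⟩ := hF [] v a hv
    simp only [List.length_nil, binomSum_nil] at hv' h ⊢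
    refine ⟨v', hv', .intro (.casePair (v₁ := .ofBits []) (v₂ := v) rfl ?_)⟩
    refine .caseNil rfl (.let_zero .nil ?_)
    refine .let_zero (.pair (v₁ := .ofBits []) (v₂ := v) rfl
      rfl) ?_
    exact h _ _ _ hU rfl
  | cons b w ih =>
    intro v a hv
    obtain ⟨v₁, hv₁, h₁⟩ := hF w v a hv
    obtain ⟨v₂, hv₂, h₂⟩ := ih v₁ _ hv₁
    refine ⟨v₂, ?_, .intro (.casePair (v₁ := .ofBits (b :: w)) (v₂ := v) rfl ?_)⟩
    · rw [List.length_cons, binomSum_succ_succ, mul_add, add_comm, Function.iterate_add_apply]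
      exact hv₂
    rw [List.length_cons, binomSum_succ_succ, mul_add, Nat.cast_add]
    refine .caseCons (v₁ := .ofBool b) (v₂ := .ofBits w) rfl ?_
    refine .share (v := .ofBits w) rfl ?_
    refine .let_zero (.pair (v₁ := .ofBits w) (v₂ := v) rfl
      rfl) ?_
    refine .letE (h₁ _ _ _ hU rfl) ?_
    refine .let_zero (.pair (v₁ := .ofBits w) (v₂ := v₁) rfl
      rfl) ?_
    exact h₂ _ _ _ rfl rfl

/-- A program `e` that evaluates as stated whenever it is given a clock of degree `i + n` does so
after `n` clocks have been defined on top of a clock of degree `i`. -/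
theorem clocks_eval {C i n : ℕ} {e : Expr} {x v : Val} {c : ℚ}
    (he : ∀ (V : Env) (F : Val), V 1 = some x → V 3 = some F → IsClock R s C (i + n) F →
      Eval V e v c)
    {V : Env} {F : Val} (h₁ : V 1 = some x) (h₃ : V 3 = some F) (hF : IsClock R s C i F) :
    Eval V (clocks n e) v c := by
  induction n generalizing i V F with
  | zero => exact he V F h₁ h₃ hF
  | succ n ih =>
    refine .let_zero .func (ih (i := i + 1) (fun V' F' h₁' h₃' hF' => he V' F' h₁' h₃' ?_)
      h₁ rfl (clockSuccBody_isClock h₃ hF))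
    rwa [add_assoc, add_comm 1] at hF'

end Simulation

/-! ### Correctness for Turing machines -/

section Machine

open TuringMachine

variable {Q Γ : Type*} (M : TuringMachine Q Γ) (cQ : Coding Q) (cΓ : Coding Γ)

/-- The tape with the cells `l` (in reversed order) and `r`, and blanks after them. -/
def tapeOf (l r : List Γ) (i : ℕ) : Γ := ((l.reverse ++ r)[i]?).getD M.blank

/-- A head beyond the stored cells reads a blank, so it may be treated as standing on a stored
blank. -/
theorem tapeOf_nil (l : List Γ) : tapeOf M l [] = tapeOf M l [M.blank] := by
  funext i
  rcases lt_trichotomy i l.length with h | h | h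
  · simp [tapeOf, List.getElem?_append, h]
  · simp [tapeOf, h]
  · have h₁ : ¬ i < l.length := by omega
    have h₂ : i - l.length ≠ 0 := by omega
    simp [tapeOf, List.getElem?_append, h₁, h₂]

theorem tapeOf_head (l r : List Γ) (a : Γ) : tapeOf M l (a :: r) l.length = a := by
  simp [tapeOf]

theorem tapeOf_moveTape (l r : List Γ) (a b : Γ) (d : Dir) :
    tapeOf M (moveTape d b l r).1 (moveTape d b l r).2 =
      Function.update (tapeOf M l (a :: r)) l.length b := by
  funext i
  rw [tapeOf, moveTape_append]
  rcases lt_trichotomy i l.length with h | h | h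
  · simp [tapeOf, List.getElem?_append, h, h.ne]
  · simp [h]
  · have h₁ : ¬ i < l.length := by omega
    have h₂ : i - l.length ≠ 0 := by omega
    simp [tapeOf, List.getElem?_append, h₁, List.getElem?_cons, h₂, h.ne']

/-- The value `v` represents the configuration `c`. -/
def Represents (v : Val) (c : Config Q Γ) : Prop :=
  ∃ l r : List Γ, c.head = l.length ∧ c.tape = tapeOf M l r ∧
    v = .cfg (cQ.enc c.state) (l.map cΓ.enc) (r.map cΓ.enc)

open scoped Classical in
/-- A step of the machine, which does nothing in the final state. -/
noncomputable def haltStep (c : Config Q Γ) : Config Q Γ :=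
  if c.state = M.qFinal then c else M.step c

theorem stepBody_simulates (U : Env) :
    Simulates (Represents M cQ cΓ) (.closure U 4 5 (stepBody M cQ cΓ)) id (haltStep M) 0 := by
  rintro _ ⟨q, h, T⟩ ⟨l, r, hh, hT, rfl⟩
  dsimp only at hh hT
  subst hh hT
  by_cases hq : q = M.qFinal
  · refine ⟨_, ⟨l, r, ?_, ?_, rfl⟩, .intro ?_⟩
    · simp [haltStep, hq]
    · simp [haltStep, hq]
    refine .casePair rfl ?_
    refine .casePair rfl ?_
    refine Expr.switch_eval (i := cQ.enc q) rfl (cQ.enc_le q) fun V' hV' => ?_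
    simp only [cQ.dec_enc, hq, if_true, haltStep]
    exact cfgExpr_eval _ (by simp [hV', Env.ext]) (by simp [hV', Env.ext])
  -- One argument covers a head on a stored cell and, with `a` blank, a head beyond the stored cells.
  have key : ∀ (a : Γ) (r' : List Γ), tapeOf M l r = tapeOf M l (a :: r') →
      ∃ v', Represents M cQ cΓ v' (haltStep M ⟨q, l.length, tapeOf M l r⟩) ∧
        ∀ V : Env, V 8 = some (.stack (l.map cΓ.enc)) → V 9 = some (.stack (r'.map cΓ.enc)) →
          Eval V (moveExpr (cQ.enc (M.δ (q, a)).1) (cΓ.enc (M.δ (q, a)).2.1) (M.δ (q, a)).2.2)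
            v' 0 := by
    intro a r' ha
    refine ⟨_, ⟨(moveTape (M.δ (q, a)).2.2 (M.δ (q, a)).2.1 l r').1,
      (moveTape (M.δ (q, a)).2.2 (M.δ (q, a)).2.1 l r').2, ?_, ?_, rfl⟩, fun V hl hr => ?_⟩
    · simp [haltStep, hq, step, ha, tapeOf_head, moveTape_length]
    · simp [haltStep, hq, step, ha, tapeOf_head, tapeOf_moveTape M l r' a]
    · simp only [haltStep, hq, if_false, step, ha, tapeOf_head]
      exact moveExpr_eval cΓ.enc _ _ _ hl hr
  cases r with
  | nil =>
    obtain ⟨v', hv', h⟩ := key M.blank [] (tapeOf_nil M l)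
    refine ⟨v', hv', .intro ?_⟩
    refine .casePair rfl ?_
    refine .casePair rfl ?_
    refine Expr.switch_eval (i := cQ.enc q) rfl (cQ.enc_le q) fun V' hV' => ?_
    simp only [cQ.dec_enc, hq, if_false]
    refine .caseNil (by simp [hV', Env.ext, Val.stack]) (.let_zero .nil (h _ ?_ ?_))
    · simp [hV', Env.ext]
    · simp [Env.ext, Val.stack]
  | cons a r =>
    obtain ⟨v', hv', h⟩ := key a r rfl
    refine ⟨v', hv', .intro ?_⟩
    refine .casePair rfl ?_
    refine .casePair rfl ?_
    refine Expr.switch_eval (i := cQ.enc q) rfl (cQ.enc_le q) fun V' hV' => ?_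
    simp only [cQ.dec_enc, hq, if_false]
    refine .caseCons ((hV' 9 (by decide)).trans rfl) ?_
    refine Expr.switch_eval (i := cΓ.enc a) rfl (cΓ.enc_le a) fun V'' hV'' => ?_
    simp only [cΓ.dec_enc]
    exact h _ (by simp [hV'', hV', Env.ext]) (by simp [hV'', Env.ext])

theorem init_represents (w : List Bool) :
    Represents M cQ cΓ
      (.cfg (cQ.enc M.q₀) [cΓ.enc M.leftEnd] (w.map fun b => cΓ.enc (M.bit b))) (M.init w) := by
  refine ⟨[M.leftEnd], w.map M.bit, rfl, ?_, by simp [init, Function.comp_def]⟩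
  funext i
  cases i with
  | zero => simp [init, initTape, tapeOf]
  | succ i =>
    cases h : w[i]? <;> simp [init, initTape, tapeOf, h]

/-- On the tape segment `r`, followed by blanks, the output function returns the bits before the
first blank. -/
theorem outBody_computes (U : Env) (u : List Bool) (r : List Γ)
    (hu : ∀ i (hi : i < u.length), (r[i]?).getD M.blank = M.bit u[i])
    (hb : (r[u.length]?).getD M.blank = M.blank) :
    (Val.closure U 4 5 (outBody cΓ.bound (bitOf M cΓ))).Computes (.stack (r.map cΓ.enc))
      (.ofBits u) 0 := by
  have hblank : ∀ b, M.bit b ≠ M.blank := fun b h => M.blank_notMem ⟨b, h⟩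
  induction u generalizing r with
  | nil =>
    cases r with
    | nil => exact .intro (.caseNil rfl .nil)
    | cons a r =>
      obtain rfl : a = M.blank := by simpa using hb
      refine .intro (.caseCons rfl ?_)
      refine Expr.switch_eval (i := cΓ.enc M.blank) rfl (cΓ.enc_le _)
        fun V' hV' => ?_
      have h : bitOf M cΓ (cΓ.enc M.blank) = none := by
        simp [bitOf, cΓ.dec_enc, (hblank _).symm]
      simp only [h]
      exact .nil
  | cons b u ih =>
    have h₀ := hu 0 (by simp)
    cases r with
    | nil => exact absurd h₀.symm (hblank b)
    | cons a r =>
      obtain rfl : a = M.bit b := by simpa using h₀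
      have ih' := ih r (fun i hi => hu (i + 1) (by simpa using hi))
        (by simpa using hb)
      refine .intro (.caseCons rfl ?_)
      refine Expr.switch_eval (i := cΓ.enc (M.bit b)) rfl (cΓ.enc_le _)
        fun V' hV' => ?_
      have h : bitOf M cΓ (cΓ.enc (M.bit b)) = some b := by
        cases b <;> simp [bitOf, cΓ.dec_enc, M.bit_injective.eq_iff]
      cases b with
      | false =>
        simp only [h]
        refine .let_zero .unit (.let_zero (.inl (v := .unit) rfl) ?_)
        refine .let_zero (ih' _ _ _ (by simp [Env.ext, hV']) (by simp [Env.ext, hV'])) ?_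
        exact .cons rfl rfl
      | true =>
        simp only [h]
        refine .let_zero .unit (.let_zero (.inr (v := .unit) rfl) ?_)
        refine .let_zero (ih' _ _ _ (by simp [Env.ext, hV']) (by simp [Env.ext, hV'])) ?_
        exact .cons rfl rfl

theorem mainExpr_eval {V : Env} {F : Val} {C k : ℕ} {w u : List Bool}
    (h₁ : V 1 = some (.ofBits w)) (h₃ : V 3 = some F)
    (hF : IsClock (Represents M cQ cΓ) (haltStep M) C k F)
    (hu : M.TapeHolds ((haltStep M)^[C * binomSum k w.length] (M.init w)).tape u) :
    Eval V (mainExpr M cQ cΓ) (.ofBits u) (C * binomSum k w.length : ℕ) := by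
  obtain ⟨_, ⟨l, r, -, hT, rfl⟩, h⟩ := hF w _ _ (init_represents M cQ cΓ w)
  rw [hT] at hu
  refine .share h₁ (.let_zero .func ?_)
  refine .let_zero (convBody_computes _ _ w _ _ _ rfl rfl) ?_
  refine .let_zero .nil (.let_zero (Expr.num_eval _ _) ?_)
  refine .let_zero (v₁ := .stack [cΓ.enc M.leftEnd]) (.cons rfl
    rfl) ?_
  refine .let_zero (cfgExpr_eval _ (l := [cΓ.enc M.leftEnd])
    (r := w.map fun b => cΓ.enc (M.bit b)) rfl rfl) ?_
  refine .let_zero (.pair (v₁ := .ofBits w) rfl rfl) ?_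
  refine .let_of_zero (h _ _ _ h₃ rfl) ?_
  refine .casePair rfl (.let_zero .func ?_)
  refine .let_zero (revBody_computes _ _ _ _ _ _ rfl rfl) ?_
  rw [← List.map_reverse, ← List.map_append]
  -- The first cell of the tape is not part of the output.
  cases hlr : l.reverse ++ r with
  | nil =>
    refine .caseNil rfl ?_
    cases u with
    | nil => exact .nil
    | cons b u =>
      have h₀ := hu.1 0 (by simp)
      simp only [tapeOf, hlr] at h₀
      exact absurd ⟨b, h₀.symm⟩ M.blank_notMem
  | cons a r' =>
    refine .caseCons rfl (.let_zero .func ?_)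
    refine outBody_computes M cΓ _ u r' ?_ ?_ _ _ _ rfl rfl
    · intro i hi
      simpa [tapeOf, hlr] using hu.1 i hi
    · simpa [tapeOf, hlr] using hu.2

theorem simulator_runs {C k : ℕ} {w u : List Bool}
    (hu : M.TapeHolds ((haltStep M)^[C * binomSum k w.length] (M.init w)).tape u) :
    (simulator M cQ cΓ C k).Runs w u (C * binomSum k w.length : ℕ) := by
  refine ⟨_, 0, _, .func, .app rfl
    rfl ?_, (zero_add _).symm⟩
  refine .let_zero .func (.let_zero .func (.let_zero .func ?_))
  refine clocks_eval (R := Represents M cQ cΓ) (s := haltStep M) (C := C) (i := 0)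
    (x := .ofBits w) (fun V F h₁ h₃ hF => mainExpr_eval M cQ cΓ h₁ h₃ (by rwa [zero_add] at hF) hu)
    rfl rfl ?_
  refine clockZeroBody_isClock rfl ?_
  exact iterBody_simulates rfl (stepBody_simulates M cQ cΓ _) C

/-- From the running time on, the iterates of `haltStep` stay at the halting configuration. -/
theorem haltStep_iterate {w : List Bool} {t m : ℕ} (h : M.HaltsIn w t) (hm : t ≤ m) :
    (haltStep M)^[m] (M.init w) = M.configAt w t := by
  have h₁ : ∀ s ≤ t, (haltStep M)^[s] (M.init w) = M.configAt w s := by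
    intro s hs
    induction s with
    | zero => rfl
    | succ s ih =>
      rw [Function.iterate_succ_apply', ih (by omega), haltStep, if_neg (h.2 s (by omega)),
        configAt, configAt, Function.iterate_succ_apply']
  obtain ⟨d, rfl⟩ := Nat.exists_eq_add_of_le hm
  have hfix : haltStep M (M.configAt w t) = M.configAt w t := if_pos h.1
  rw [add_comm, Function.iterate_add_apply, h₁ t le_rfl, Function.iterate_fixed hfix]

theorem _root_.TuringMachine.HaltsIn.unique {M : TuringMachine Q Γ} {w : List Bool} {t t' : ℕ}
    (h : M.HaltsIn w t) (h' : M.HaltsIn w t') : t = t' := by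
  rcases lt_trichotomy t t' with hlt | heq | hgt
  · exact absurd h.1 (h'.2 t hlt)
  · exact heq
  · exact absurd h'.1 (h.2 t' hgt)

end Machine

/-! ### Polynomials and binomial sums -/

theorem binomSum_mono {i j : ℕ} (h : i ≤ j) (n : ℕ) : binomSum i n ≤ binomSum j n :=
  Finset.sum_le_sum_of_subset (Finset.range_mono (by omega))

theorem mul_binomSum_le (i n : ℕ) : n * binomSum i n ≤ 2 * (i + 1) * binomSum (i + 1) n := by
  have h₁ : ∀ j ∈ Finset.range (i + 1),
      n * n.choose j ≤ (i + 1) * n.choose j + (i + 1) * n.choose (j + 1) := by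
    intro j hj
    have hj' : j + 1 ≤ i + 1 := Finset.mem_range.mp hj
    rcases le_or_gt n j with hn | hn
    · have : n * n.choose j ≤ (i + 1) * n.choose j := Nat.mul_le_mul_right _ (by omega)
      omega
    · have h := Nat.choose_succ_right_eq n j
      calc n * n.choose j = ((n - j) + j) * n.choose j := by rw [Nat.sub_add_cancel hn.le]
        _ = n.choose j * (n - j) + j * n.choose j := by ring
        _ = (j + 1) * n.choose (j + 1) + j * n.choose j := by rw [← h, mul_comm]
        _ ≤ (i + 1) * n.choose (j + 1) + (i + 1) * n.choose j := by gcongr; omega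
        _ = _ := add_comm _ _
  have h₂ : ∑ j ∈ Finset.range (i + 1), n.choose (j + 1) ≤ binomSum (i + 1) n := by
    rw [binomSum, Finset.sum_range_succ' _ (i + 1)]
    exact Nat.le_add_right _ _
  calc n * binomSum i n ≤ (i + 1) * binomSum i n +
        (i + 1) * ∑ j ∈ Finset.range (i + 1), n.choose (j + 1) := by
        rw [binomSum, Finset.mul_sum, Finset.mul_sum, Finset.mul_sum, ← Finset.sum_add_distrib]
        exact Finset.sum_le_sum h₁
    _ ≤ (i + 1) * binomSum (i + 1) n + (i + 1) * binomSum (i + 1) n := by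
        gcongr
        exact binomSum_mono (by omega) n
    _ = _ := by ring

theorem exists_pow_le_binomSum (d : ℕ) : ∃ C, ∀ n, n ^ d ≤ C * binomSum d n := by
  induction d with
  | zero => exact ⟨1, fun n => by simp [binomSum_zero]⟩
  | succ d ih =>
    obtain ⟨C, hC⟩ := ih
    refine ⟨C * (2 * (d + 1)), fun n => ?_⟩
    calc n ^ (d + 1) = n ^ d * n := pow_succ n d
      _ ≤ C * binomSum d n * n := Nat.mul_le_mul_right n (hC n)
      _ = C * (n * binomSum d n) := by ring
      _ ≤ C * (2 * (d + 1) * binomSum (d + 1) n) := Nat.mul_le_mul_left C (mul_binomSum_le d n)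
      _ = _ := by ring

/-- The clocks `C * binomSum k n` majorize all polynomials. -/
theorem exists_eval_le_binomSum (p : Polynomial ℕ) :
    ∃ C k, ∀ n, p.eval n ≤ C * binomSum k n := by
  induction p using Polynomial.induction_on' with
  | add p q hp hq =>
    obtain ⟨C, k, h⟩ := hp
    obtain ⟨C', k', h'⟩ := hq
    refine ⟨C + C', max k k', fun n => ?_⟩
    rw [Polynomial.eval_add, add_mul]
    exact add_le_add
      ((h n).trans (Nat.mul_le_mul_left C (binomSum_mono (le_max_left _ _) n)))
      ((h' n).trans (Nat.mul_le_mul_left C' (binomSum_mono (le_max_right _ _) n)))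
  | monomial d a =>
    obtain ⟨C, hC⟩ := exists_pow_le_binomSum d
    refine ⟨a * C, d, fun n => ?_⟩
    rw [Polynomial.eval_monomial, mul_assoc]
    exact Nat.mul_le_mul_left a (hC n)

/-- The potential of the input is exactly the cost of the clock of degree `k`. -/
theorem add_phi_clock (C k n : ℕ) :
    (C : ℚ≥0) + (Pot.clock k C k).phi n = (C * binomSum k n : ℕ) := by
  have h : (Pot.clock k C k).phi n = C * ∑ i ∈ Finset.range k, (n.choose (i + 1) : ℚ≥0) := by
    rw [← Fin.sum_univ_eq_sum_range fun i => (n.choose (i + 1) : ℚ≥0), Finset.mul_sum]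
    exact Finset.sum_congr rfl fun i _ => by simp [Pot.clock]
  rw [h, binomSum, Finset.sum_range_succ']
  push_cast
  simp
  ring

end RaML

theorem mainTheorem1 {Q Γ : Type*} [Finite Q] [Finite Γ] (M : TuringMachine Q Γ)
    (hM : M.PolyTime) :
    ∃ (P : RaML.Expr) (k : ℕ) (q r : RaML.Pot k) (p s : ℚ≥0),
      RaML.Infers k P ⟨RaML.BTy.bits q, p, RaML.BTy.bits r, s⟩ ∧
      ∀ (w u : List Bool) (t : ℕ), M.Runs w u t →
        ∃ c : ℚ, P.Runs w u c ∧ (t : ℚ) ≤ c ∧ c ≤ ((p + q.phi w.length : ℚ≥0) : ℚ) := by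
  obtain ⟨cQ⟩ := RaML.Coding.nonempty Q M.q₀
  obtain ⟨cΓ⟩ := RaML.Coding.nonempty Γ M.blank
  obtain ⟨P, hP⟩ := hM
  obtain ⟨C, k, hC⟩ := RaML.exists_eval_le_binomSum P
  refine ⟨_, k, _, _, _, _, RaML.simulator_infers M cQ cΓ C k, fun w u t ⟨ht, hu⟩ => ?_⟩
  obtain ⟨u', t', ⟨ht', -⟩, hle⟩ := hP w
  have hle' : t ≤ C * RaML.binomSum k w.length := by
    rw [ht.unique ht']
    exact hle.trans (hC _)
  refine ⟨_, RaML.simulator_runs M cQ cΓ (C := C) (k := k) ?_, by exact_mod_cast hle', ?_⟩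
  · rwa [RaML.haltStep_iterate M ht hle']
  rw [RaML.add_phi_clock]
  simp
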